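/- Let $\Lambda=\mathbb C[p_1,p_2,p_3,\dots]$ be the ring of symmetric functions, $p_k=\sum_{i\ge1}x_i^k$, and define the Bernstein operators $B_n$ ($n\in\mathbb Z$) on $\Lambda$ by $$\sum_{n\in\mathbb Z}B_nt^n=\exp\Big(\sum_{k\ge1}\frac{t^k}{k}p_k\Big)\exp\Big(-\sum_{k\ge1}t^{-k}\frac{\partial}{\partial p_k}\Big),$$ with $B_\mu=B_{\mu_1}B_{\mu_2}\cdots B_{\mu_l}$ for a sequence of integers $\mu=(\mu_1,\dots,\mu_l)$. The code of $\mu$ is the doubly infinite sequence of letters $R,L,U$ (unit steps right, left, up) obtained by going up the negative $y$-axis to the bottom row of the diagram of $\mu$ (left-aligned rows of lengths $\mu_1,\dots,\mu_l$ from top to bottom, in the fourth quadrant), tracing the right edge of the diagram up to the $x$-axis, and then going right along the $x$-axis. For fixed $l$, sequences of length $l$ correspond one to one to their codes; if $\alpha$ and $\beta$ are the codes of $\mu$ and $\nu$, both of length $l$, write $\alpha\sim\beta$ if $B_\mu=B_\nu$, and $\alpha\sim-\beta$ if $B_\mu=-B_\nu$. For a composition $\mu=(\mu_1,\dots,\mu_l)$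 with nonnegative integer parts let $\delta=(l-1,\dots,1,0)$, $a_\mu=\det(x_i^{\mu_j})_{1\le i,j\le l}$, and let $s_\mu(x_1,\dots,x_l)=a_{\mu+\delta}/a_\delta$ be the Schur polynomial indexed by $\mu$. Let $\Lambda_k$ be the span of the classical Schur functions $s_\lambda$ of partitions $\lambda$ with exactly $k$ positive parts, and let $s_\mu$, the Schur function indexed by $\mu$, be the unique element of $\bigoplus_{k=0}^l\Lambda_k$ whose restriction to $x_{l+1}=x_{l+2}=\cdots=0$ is $s_\mu(x_1,\dots,x_l)$. **Theorem 5.3.** Let $\mu$ and $\nu$ be compositions of length $l$ with nonnegative parts, with codes $\alpha$ and $\beta$. Then $s_\mu$ and $s_\nu$ are well defined (exactly one symmetric function has the defining property of each), and $$s_\mu=s_\nu\iff\alpha\sim\beta,\qquad\qquad s_\mu=-s_\nu\iff\alpha\sim-\beta .$$ -/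

import Mathlib

noncomputable section

namespace SchurCode

/-! ### The ring of symmetric functions and the Bernstein operators -/

/-- The ring of symmetric functions `Λ = ℂ[p₁, p₂, p₃, …]`; the variable `X k` stands for the
power sum `p_{k+1}`. -/
abbrev Lam : Type := MvPolynomial ℕ ℂ

/-- The coefficient of `tⁿ` in the formal exponential `exp F = ∑ⱼ Fʲ / j!` of a power series `F`
with zero constant coefficient, over a (not necessarily commutative) `ℂ`-algebra. Since `Fʲ` is
divisible by `tʲ`, only the terms `j ≤ n` contribute. -/
def expCoeff {A : Type} [Ring A] [Algebra ℂ A] (F : PowerSeries A) (n : ℕ) : A :=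
  ∑ j ∈ Finset.range (n + 1), ((Nat.factorial j : ℂ)⁻¹) • PowerSeries.coeff n (F ^ j)

/-- The series `∑_{k ≥ 1} (tᵏ / k) p_k`, where `p_k` acts on `Λ` by multiplication. -/
def multSeries : PowerSeries (Module.End ℂ Lam) :=
  PowerSeries.mk fun k => match k with
    | 0 => 0
    | k + 1 => (((k + 1 : ℕ) : ℂ)⁻¹) • LinearMap.mulLeft ℂ (MvPolynomial.X k : Lam)

/-- The series `-∑_{k ≥ 1} uᵏ ∂/∂p_k` (to be used with `u = t⁻¹`). -/
def derivSeries : PowerSeries (Module.End ℂ Lam) :=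
  PowerSeries.mk fun k => match k with
    | 0 => 0
    | k + 1 => -((MvPolynomial.pderiv k : Derivation ℂ Lam Lam) : Lam →ₗ[ℂ] Lam)

/-- The degree of a monomial, where `p_k` has degree `k`. -/
def wt : (ℕ →₀ ℕ) →+ ℕ := Finsupp.weight fun k => k + 1

/-- Symmetric functions all of whose monomials in the `p_k` have degree `< d`. -/
def degLT (d : ℕ) : Submodule ℂ Lam where
  carrier := {f | ∀ m, f.coeff m ≠ 0 → wt m < d}
  zero_mem' := by intro m hm; simp at hm
  add_mem' := by
    intro f g hf hg m hm
    by_cases h : f.coeff m = 0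
    · exact hg m (by intro h'; simp [h, h'] at hm)
    · exact hf m h
  smul_mem' := by
    intro c f hf m hm
    refine hf m (fun h => hm ?_)
    simp [h]

theorem exists_mem_degLT (f : Lam) : ∃ d, f ∈ degLT d := by
  refine ⟨f.support.sup wt + 1, fun m hm => Nat.lt_succ_of_le ?_⟩
  exact Finset.le_sup (f := wt) (MvPolynomial.mem_support_iff.2 hm)

theorem eq_zero_of_mem_degLT_zero {f : Lam} (hf : f ∈ degLT 0) : f = 0 := by
  ext m
  by_contra h
  exact absurd (hf m h) (Nat.not_lt_zero _)

theorem derivSeries_mem {d : ℕ} (c : ℕ) {f : Lam} (hf : f ∈ degLT d) :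
    PowerSeries.coeff c derivSeries f ∈ degLT (d - c) := by
  cases c with
  | zero => simp [derivSeries]
  | succ k =>
    simp only [derivSeries, PowerSeries.coeff_mk, LinearMap.neg_apply]
    refine Submodule.neg_mem _ fun m hm => ?_
    have hm' : MvPolynomial.coeff m (MvPolynomial.pderiv k f) ≠ 0 := hm
    rw [MvPolynomial.coeff_pderiv] at hm'
    have h := hf _ (left_ne_zero_of_mul hm')
    have h2 : wt (m + Finsupp.single k 1) = wt m + (k + 1) := by
      simp [wt, Finsupp.weight_single]
    omega

theorem derivSeries_pow_mem (j : ℕ) {d : ℕ} (c : ℕ) {f : Lam} (hf : f ∈ degLT d) :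
    PowerSeries.coeff c (derivSeries ^ j) f ∈ degLT (d - c) := by
  induction j generalizing c d f with
  | zero =>
    rw [pow_zero, PowerSeries.coeff_one]
    split_ifs with h
    · simpa [h] using hf
    · simp
  | succ j ih =>
    rw [pow_succ, PowerSeries.coeff_mul, LinearMap.sum_apply]
    refine Submodule.sum_mem _ fun p hp => ?_
    have h := ih p.1 (derivSeries_mem p.2 hf)
    rw [Finset.HasAntidiagonal.mem_antidiagonal] at hp
    rwa [Nat.sub_sub, add_comm p.2, hp] at h

/-- The coefficients of `exp(-∑_{k ≥ 1} uᵏ ∂/∂p_k)` are locally finite: each symmetric function is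
killed by almost all of them. -/
theorem exists_derivCoeff_eq_zero (f : Lam) :
    ∃ d, ∀ b, d ≤ b → expCoeff derivSeries b f = 0 := by
  obtain ⟨d, hd⟩ := exists_mem_degLT f
  refine ⟨d, fun b hb => eq_zero_of_mem_degLT_zero ?_⟩
  rw [expCoeff, LinearMap.sum_apply]
  refine Submodule.sum_mem _ fun j _ => ?_
  rw [LinearMap.smul_apply]
  refine Submodule.smul_mem _ _ ?_
  have h := derivSeries_pow_mem j b hd
  rwa [Nat.sub_eq_zero_of_le hb] at h

/-- The sum defining a Bernstein operator has only finitely many nonzero terms on each symmetric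
function. -/
theorem bernstein_support_finite (n : ℤ) (f : Lam) :
    ({ab : ℕ × ℕ | (ab.1 : ℤ) - ab.2 = n} ∩ Function.support fun ab : ℕ × ℕ =>
      expCoeff multSeries ab.1 (expCoeff derivSeries ab.2 f)).Finite := by
  obtain ⟨d, hd⟩ := exists_derivCoeff_eq_zero f
  refine ((Set.finite_Iio (n + d).toNat).prod (Set.finite_Iio d)).subset ?_
  rintro ⟨a, b⟩ ⟨h1, h2⟩
  have hb : b < d := by
    by_contra hb
    exact h2 (by simp [hd b (not_lt.1 hb)])
  simp only [Set.mem_ofPred_eq] at h1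
  simp only [Set.mem_prod, Set.mem_Iio]
  omega

/-- The Bernstein operator `B_n` on `Λ`: the coefficient of `tⁿ` in
`B(t) = exp(∑_{k ≥ 1} (tᵏ / k) p_k) exp(-∑_{k ≥ 1} t⁻ᵏ ∂/∂p_k)`. -/
def bernstein (n : ℤ) : Module.End ℂ Lam where
  toFun f := ∑ᶠ (ab : ℕ × ℕ) (_ : ab ∈ {ab : ℕ × ℕ | (ab.1 : ℤ) - ab.2 = n}),
    expCoeff multSeries ab.1 (expCoeff derivSeries ab.2 f)
  map_add' f g := by
    simp only [map_add]
    exact finsum_mem_add_distrib' (bernstein_support_finite n f) (bernstein_support_finite n g)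
  map_smul' c f := by
    simp only [map_smul, RingHom.id_apply, smul_finsum]

/-- `B_μ = B_{μ₁} B_{μ₂} ⋯ B_{μ_l}`. -/
def bernsteinComp {l : ℕ} (μ : Fin l → ℤ) : Module.End ℂ Lam :=
  (List.ofFn fun i => bernstein (μ i)).prod

/-! ### Codes of compositions -/

/-- Unit steps right, left and up. -/
inductive Step : Type
  | R
  | L
  | U

/-- Doubly infinite sequences of steps. -/
abbrev Code : Type := ℤ → Step

/-- The horizontal path of net displacement `d`. -/
def horizontal (d : ℤ) : List Step :=
  if 0 ≤ d then List.replicate d.toNat Step.R else List.replicate (-d).toNat Step.L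

/-- The path along the right edge of a diagram with the given row lengths, listed from the bottom
row to the top row, for a path starting at horizontal position `x`. -/
def codeWord : ℤ → List ℤ → List Step
  | _, [] => []
  | x, m :: rows => horizontal (m - x) ++ Step.U :: codeWord m rows

/-- The code of the composition `μ = (μ₁, …, μ_l)`: go up along the negative `y`-axis to the bottom
row `μ_l`, follow the right edge of the diagram up to the `x`-axis, and go right along the `x`-axis
forever. The steps on the `x`-axis after the last step up have the indices `0, 1, 2, …`. -/
def code {l : ℕ} (μ : Fin l → ℤ) : Code := fun n =>
  if 0 ≤ n then Step.R
  else (codeWord 0 (List.ofFn μ).reverse).reverse.getD (-n - 1).toNat Step.U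

theorem horizontal_injective {d e : ℤ} (h : horizontal d = horizontal e) : d = e := by
  unfold horizontal at h
  split_ifs at h with h1 h2 h2
  · have := congrArg List.length h
    simp at this
    omega
  · obtain ⟨n, hn⟩ : ∃ n, (-e).toNat = n + 1 := ⟨(-e).toNat - 1, by omega⟩
    rw [hn] at h
    cases hm : d.toNat <;> rw [hm] at h <;> simp [List.replicate_succ] at h
  · obtain ⟨n, hn⟩ : ∃ n, (-d).toNat = n + 1 := ⟨(-d).toNat - 1, by omega⟩
    rw [hn] at h
    cases hm : e.toNat <;> rw [hm] at h <;> simp [List.replicate_succ] at h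
  · have := congrArg List.length h
    simp at this
    omega

theorem up_notMem_horizontal (d : ℤ) : Step.U ∉ horizontal d := by
  unfold horizontal
  split_ifs <;> simp [List.mem_replicate]

theorem append_up_cancel {a b c d : List Step} (ha : Step.U ∉ a) (hb : Step.U ∉ b)
    (h : a ++ Step.U :: c = b ++ Step.U :: d) : a = b ∧ c = d := by
  induction a generalizing b with
  | nil =>
    cases b with
    | nil => exact ⟨rfl, by simpa using h⟩
    | cons y b =>
      simp only [List.nil_append, List.cons_append, List.cons.injEq] at h
      exact absurd (by simp [h.1]) hb
  | cons x a ih =>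
    cases b with
    | nil =>
      simp only [List.nil_append, List.cons_append, List.cons.injEq] at h
      exact absurd (by simp [h.1]) ha
    | cons y b =>
      simp only [List.cons_append, List.cons.injEq, List.mem_cons, not_or] at h ha hb
      obtain ⟨h1, h2⟩ := ih ha.2 hb.2 h.2
      exact ⟨by rw [h.1, h1], h2⟩

theorem codeWord_injective (x : ℤ) (r s : List ℤ) (h : codeWord x r = codeWord x s) : r = s := by
  induction r generalizing x s with
  | nil =>
    cases s with
    | nil => rfl
    | cons m s => simp [codeWord] at h
  | cons n r ih =>
    cases s with
    | nil => simp [codeWord] at h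
    | cons m s =>
      simp only [codeWord] at h
      have h' := append_up_cancel (up_notMem_horizontal _)
        (up_notMem_horizontal _) h
      have hnm : n = m := by
        have := horizontal_injective h'.1
        omega
      subst hnm
      rw [ih n s h'.2]

open Classical in
theorem count_up_codeWord (x : ℤ) (r : List ℤ) :
    (codeWord x r).count Step.U = r.length := by
  induction r generalizing x with
  | nil => simp [codeWord]
  | cons n r ih =>
    simp [codeWord, ih, List.count_eq_zero_of_not_mem (up_notMem_horizontal _)]

open Classical in
theorem eq_of_getD_up (a b : List Step) (hc : a.count Step.U = b.count Step.U)
    (h : ∀ i, a.getD i Step.U = b.getD i Step.U) : a = b := by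
  induction a generalizing b with
  | nil =>
    cases b with
    | nil => rfl
    | cons y b =>
      have h0 : Step.U = y := by simpa using h 0
      subst h0
      simp at hc
  | cons x a ih =>
    cases b with
    | nil =>
      have h0 : x = Step.U := by simpa using h 0
      subst h0
      simp at hc
    | cons y b =>
      have h0 : x = y := by simpa using h 0
      subst h0
      rw [ih b]
      · simpa [List.count_cons] using hc
      · intro i
        simpa using h (i + 1)

/-- Compositions of a fixed length correspond one to one to their codes. -/
theorem code_injective {l : ℕ} : Function.Injective (code : (Fin l → ℤ) → Code) := by
  intro μ ν h
  have hw : (codeWord 0 (List.ofFn μ).reverse).reverse =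
      (codeWord 0 (List.ofFn ν).reverse).reverse := by
    apply eq_of_getD_up
    · simp [count_up_codeWord]
    · intro i
      have hi := congrFun h (-(i : ℤ) - 1)
      have h1 : ¬ (0 ≤ -(i : ℤ) - 1) := by omega
      have h2 : (-(-(i : ℤ) - 1) - 1).toNat = i := by omega
      simpa only [code, if_neg h1, h2] using hi
  exact List.ofFn_injective
    (List.reverse_injective (codeWord_injective 0 _ _ (List.reverse_injective hw)))

/-- Signed codes; `(1, α)` is `α` and `(-1, α)` is `-α`. -/
abbrev SignedCode : Type := ℤˣ × Code

/-- The relation `∼` on signed codes of compositions of length `l`: for the codes `α` of `μ` and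
`β` of `ν`, the signed codes `±α` and `±β` are related if and only if `±B_μ = ±B_ν`. -/
def CodeSim (l : ℕ) (a b : SignedCode) : Prop :=
  ∃ μ ν : Fin l → ℤ, code μ = a.2 ∧ code ν = b.2 ∧
    (a.1 : ℤ) • bernsteinComp μ = (b.1 : ℤ) • bernsteinComp ν

/-! ### Schur functions indexed by compositions -/

/-- The restriction `x_{N+1} = x_{N+2} = ⋯ = 0` of a symmetric function to `N` variables. -/
def restrict (N : ℕ) : Lam →ₐ[ℂ] MvPolynomial (Fin N) ℂ :=
  MvPolynomial.aeval fun k => MvPolynomial.psum (Fin N) ℂ (k + 1)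

/-- The alternant `a_e = det (x_i ^ e_j)`. -/
def alternant {N : ℕ} (e : Fin N → ℕ) : MvPolynomial (Fin N) ℂ :=
  (Matrix.of fun i j : Fin N => (MvPolynomial.X i : MvPolynomial (Fin N) ℂ) ^ e j).det

/-- `δ = (N - 1, N - 2, …, 1, 0)`. -/
def delta (N : ℕ) : Fin N → ℕ := fun j => N - 1 - j

/-- The Schur polynomial `a_{μ+δ} / a_δ` indexed by a composition with nonnegative parts, as an
element of the field of rational functions. -/
def schurPoly {N : ℕ} (μ : Fin N → ℕ) : FractionRing (MvPolynomial (Fin N) ℂ) :=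
  algebraMap _ _ (alternant (μ + delta N)) / algebraMap _ _ (alternant (delta N))

/-- The symmetric function `f` is the classical Schur function `s_λ`: in every number `N ≥ k` of
variables it restricts to the Schur polynomial of `λ = (λ₁, …, λ_k, 0, …, 0)`. -/
def IsClassicalSchur {k : ℕ} (lam : Fin k → ℕ) (f : Lam) : Prop :=
  ∀ N, k ≤ N → algebraMap (MvPolynomial (Fin N) ℂ) (FractionRing (MvPolynomial (Fin N) ℂ))
    (restrict N f) = schurPoly fun i : Fin N => if h : (i : ℕ) < k then lam ⟨i, h⟩ else 0

/-- `Λ_k`: the span of the classical Schur functions of the partitions with exactly `k` (positive)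
parts. -/
def LamLen (k : ℕ) : Submodule ℂ Lam :=
  Submodule.span ℂ {f | ∃ lam : Fin k → ℕ,
    Antitone lam ∧ (∀ i, 0 < lam i) ∧ IsClassicalSchur lam f}

/-- The property that characterizes the Schur function indexed by the composition `μ` of length
`l`: it lies in `⨁_{k ≤ l} Λ_k` and restricts to the Schur polynomial of `μ` in `l` variables. -/
def IsSchurFunction {l : ℕ} (μ : Fin l → ℕ) (f : Lam) : Prop :=
  f ∈ (⨆ k ∈ Finset.range (l + 1), LamLen k) ∧
    algebraMap (MvPolynomial (Fin l) ℂ) (FractionRing (MvPolynomial (Fin l) ℂ))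
      (restrict l f) = schurPoly μ

/-- The Schur function `s_μ` indexed by the composition `μ`. -/
def schurFunction {l : ℕ} (μ : Fin l → ℕ) : Lam :=
  Classical.epsilon (IsSchurFunction μ)

end SchurCode

end

/-! The Schur function indexed by `μ` is `B_μ 1`, and everything follows from the values of
symmetric functions on finite sets `S` of elements of a field. By Taylor's formula, `exp(-∑ xᵏ
∂/∂p_k)` substitutes `p_k - xᵏ` for `p_k`, that is, it removes `x` from `S`. Moreover `h_m(S)` is
the divided difference of the power of exponent `m + |S| - 1`. Together they give, for `n + |S| ≥
1`, `(B_n f)(S) = ∑_{x ∈ S} x^(n+|S|-1) / ∏_{y ≠ x} (x - y) * f(S \ {x})` (`evalSet_bernstein`).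

Applied twice, this formula is antisymmetric in its two exponents. As values on large finite sets
determine a symmetric function, `B_m B_n = -B_{n-1} B_{m+1}`, so `B_μ` is alternating in `μ + δ`
(`bernsteinExp_comp_perm`). Applied `l` times to `1`, it is the Laplace expansion of a determinant,
so `B_μ 1` restricts to `a_{μ+δ} / a_δ` in `l` variables (`restrict_schurB_mul`). Sorting `μ + δ`
puts `B_μ 1` in the span of the classical Schur functions with at most `l` parts, on which
restriction to `l` variables is injective; hence `s_μ = B_μ 1`.

If `s_μ = ±s_ν ≠ 0`, the alternants agree up to sign, so `μ + δ` and `ν + δ` are rearrangements of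
each other and `B_μ = ±B_ν` as operators (`schurB_eq_smul_iff`). If `s_μ = 0`, both shifted
sequences have repeated entries and both operators vanish. The converse is evaluation at `1`. -/

noncomputable section

namespace SchurCode

open PowerSeries

/-! ### Formal exponentials of power series -/

section Exponentials

variable {A B : Type} [Ring A] [Algebra ℂ A] [Ring B] [Algebra ℂ B]

theorem coeff_pow_eq_zero {A : Type} [Ring A] {F : PowerSeries A} (hF : coeff 0 F = 0) {n j : ℕ} (h : n < j) :
    coeff n (F ^ j) = 0 := by
  induction j generalizing n with
  | zero => omega
  | succ j ih =>
    rw [pow_succ, coeff_mul]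
    refine Finset.sum_eq_zero fun p hp => ?_
    rw [Finset.HasAntidiagonal.mem_antidiagonal] at hp
    rcases Nat.eq_zero_or_pos p.2 with h2 | h2
    · rw [h2, hF, mul_zero]
    · rw [ih (by omega), zero_mul]

theorem expCoeff_eq_sum_range {F : PowerSeries A} (hF : coeff 0 F = 0) {n N : ℕ} (h : n < N) :
    expCoeff F n = ∑ j ∈ Finset.range N, ((Nat.factorial j : ℂ)⁻¹) • coeff n (F ^ j) := by
  refine Finset.sum_subset (Finset.range_mono h) fun j _ hj => ?_
  rw [Finset.mem_range, not_lt] at hj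
  rw [coeff_pow_eq_zero hF (by omega), smul_zero]

theorem expCoeff_map (φ : A →ₐ[ℂ] B) (F : PowerSeries A) (n : ℕ) :
    expCoeff (PowerSeries.map (φ : A →+* B) F) n = φ (expCoeff F n) := by
  simp only [expCoeff, map_sum, ← map_pow, coeff_map, map_smul]
  rfl

theorem expCoeff_zero (F : PowerSeries A) : expCoeff F 0 = 1 := by
  simp [expCoeff]

theorem inv_factorial_succ_smul_succ_smul {M : Type*} [AddCommGroup M] [Module ℂ M] (j : ℕ)
    (x : M) : ((Nat.factorial (j + 1) : ℂ)⁻¹) • ((j + 1 : ℕ) : ℂ) • x =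
      ((Nat.factorial j : ℂ)⁻¹) • x := by
  rw [smul_smul, Nat.factorial_succ]
  congr 1
  have h1 : ((j + 1 : ℕ) : ℂ) ≠ 0 := Nat.cast_ne_zero.2 (by omega)
  have h2 : (Nat.factorial j : ℂ) ≠ 0 := Nat.cast_ne_zero.2 (Nat.factorial_ne_zero j)
  rw [Nat.cast_mul]
  field_simp

end Exponentials

/-- The formal exponential of a power series with zero constant coefficient. -/
def expSeries {A : Type} [Ring A] [Algebra ℂ A] (F : PowerSeries A) : PowerSeries A :=
  PowerSeries.mk (expCoeff F)

/-- Together with `eq_of_derivative_eq_mul`, this differential equation identifies exponentials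
without a product formula for them. -/
theorem derivative_expSeries {A : Type} [CommRing A] [Algebra ℂ A] {F : PowerSeries A}
    (hF : coeff 0 F = 0) :
    derivative A (expSeries F) = derivative A F * expSeries F := by
  ext n
  have h1 : coeff n (derivative A (expSeries F)) =
      ∑ j ∈ Finset.range (n + 2), ((Nat.factorial j : ℂ)⁻¹) •
        coeff n (derivative A (F ^ j)) := by
    rw [coeff_derivative, expSeries, coeff_mk, expCoeff, Finset.sum_mul]
    simp only [coeff_derivative, smul_mul_assoc]
  rw [h1, Finset.sum_range_succ']
  have h2 : ∀ j, ((Nat.factorial (j + 1) : ℂ)⁻¹) • coeff n (derivative A (F ^ (j + 1))) =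
      ((Nat.factorial j : ℂ)⁻¹) • coeff n (derivative A F * F ^ j) := by
    intro j
    have : derivative A (F ^ (j + 1)) = (j + 1 : ℕ) • (derivative A F * F ^ j) := by
      rw [derivative_pow]
      simp only [Nat.add_sub_cancel, nsmul_eq_mul]
      ring
    rw [← inv_factorial_succ_smul_succ_smul j, this, map_nsmul, Nat.cast_smul_eq_nsmul]
  simp only [h2]
  simp only [pow_zero, derivative_one, map_zero, smul_zero, add_zero, coeff_mul]
  simp only [Finset.smul_sum]
  rw [Finset.sum_comm]
  refine Finset.sum_congr rfl fun p hp => ?_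
  rw [Finset.HasAntidiagonal.mem_antidiagonal] at hp
  rw [expSeries, coeff_mk, expCoeff_eq_sum_range hF (show p.2 < n + 1 by omega), Finset.mul_sum]
  simp only [mul_smul_comm]

/-- The equation is a recursion that expresses `n + 1` times the coefficient of index `n + 1` by
earlier ones; characteristic zero permits the division. -/
theorem eq_of_derivative_eq_mul {K : Type} [Field K] [CharZero K] {W G H : PowerSeries K}
    (hG : derivative K G = W * G) (hH : derivative K H = W * H) (h0 : coeff 0 G = coeff 0 H) :
    G = H := by
  ext n
  induction n using Nat.strong_induction_on with
  | _ n ih =>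
    cases n with
    | zero => exact h0
    | succ n =>
      have hn : ((n : K) + 1) ≠ 0 := Nat.cast_add_one_ne_zero n
      have h : coeff n (derivative K G) = coeff n (derivative K H) := by
        rw [hG, hH, coeff_mul, coeff_mul]
        refine Finset.sum_congr rfl fun p hp => ?_
        rw [Finset.HasAntidiagonal.mem_antidiagonal] at hp
        rw [ih p.2 (by omega)]
      rw [coeff_derivative, coeff_derivative] at h
      exact mul_right_cancel₀ hn h

/-- The series `∑_{k ≥ 1} (tᵏ / k) p_k` for elements `p_{k+1} = v k` of a `ℂ`-algebra. -/
def powerSumSeries {A : Type} [Ring A] [Algebra ℂ A] (v : ℕ → A) : PowerSeries A :=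
  PowerSeries.mk fun k => match k with
    | 0 => 0
    | k + 1 => (((k + 1 : ℕ) : ℂ)⁻¹) • v k

theorem coeff_zero_powerSumSeries {A : Type} [Ring A] [Algebra ℂ A] (v : ℕ → A) :
    coeff 0 (powerSumSeries v) = 0 := by
  simp [powerSumSeries]

theorem derivative_powerSumSeries {A : Type} [CommRing A] [Algebra ℂ A] (v : ℕ → A) :
    derivative A (powerSumSeries v) = PowerSeries.mk v := by
  ext n
  rw [coeff_derivative, powerSumSeries, coeff_mk, coeff_mk]
  have h : ((n : A) + 1) = algebraMap ℂ A ((n + 1 : ℕ) : ℂ) := by simp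
  rw [h, mul_comm, ← Algebra.smul_def, smul_smul, mul_inv_cancel₀, one_smul]
  exact Nat.cast_ne_zero.2 (by omega)

theorem map_powerSumSeries {A B : Type} [Ring A] [Algebra ℂ A] [Ring B] [Algebra ℂ B]
    (φ : A →ₐ[ℂ] B) (v : ℕ → A) :
    PowerSeries.map (φ : A →+* B) (powerSumSeries v) = powerSumSeries fun k => φ (v k) := by
  ext n
  cases n <;> simp [powerSumSeries]

/-! ### The coefficients of the two exponentials as operators -/

/-- The complete homogeneous symmetric function `h_a`. -/
def hsymFun (a : ℕ) : Lam := expCoeff (powerSumSeries MvPolynomial.X) a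

theorem expCoeff_multSeries (a : ℕ) (f : Lam) : expCoeff multSeries a f = hsymFun a * f := by
  have h : multSeries = PowerSeries.map
      ((Algebra.lmul ℂ Lam : Lam →ₐ[ℂ] Module.End ℂ Lam) : Lam →+* Module.End ℂ Lam)
      (powerSumSeries MvPolynomial.X) := by
    rw [map_powerSumSeries]
    rfl
  rw [h, expCoeff_map]
  rfl

theorem map_hsymFun {A : Type} [CommRing A] [Algebra ℂ A] (φ : Lam →ₐ[ℂ] A) (a : ℕ) :
    φ (hsymFun a) = expCoeff (powerSumSeries fun k => φ (MvPolynomial.X k)) a := by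
  rw [hsymFun, ← expCoeff_map, map_powerSumSeries]

theorem coeff_zero_derivSeries : coeff 0 derivSeries = 0 := by
  simp [derivSeries]

/-- This is the Weyl relation between `∂/∂p_k` and multiplication by `p_k`. The commutator is
central, so powers of the series obey a Leibniz rule. -/
theorem derivSeries_mul_C (k : ℕ) :
    derivSeries * C (LinearMap.mulLeft ℂ (MvPolynomial.X k : Lam)) =
      C (LinearMap.mulLeft ℂ (MvPolynomial.X k : Lam)) * derivSeries - X ^ (k + 1) := by
  ext1 n
  rw [map_sub, coeff_mul_C, coeff_C_mul, coeff_X_pow]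
  refine LinearMap.ext fun f => ?_
  cases n with
  | zero => simp [derivSeries]
  | succ n =>
    by_cases h : n = k
    · subst h
      simp [derivSeries, Derivation.leibniz]
      ring
    · have h' : k ≠ n := Ne.symm h
      simp [derivSeries, Derivation.leibniz, MvPolynomial.pderiv_X_of_ne h', h]

theorem derivSeries_pow_mul_C (k j : ℕ) :
    derivSeries ^ (j + 1) * C (LinearMap.mulLeft ℂ (MvPolynomial.X k : Lam)) =
      C (LinearMap.mulLeft ℂ (MvPolynomial.X k : Lam)) * derivSeries ^ (j + 1) -
        (j + 1 : ℕ) • (derivSeries ^ j * X ^ (k + 1)) := by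
  induction j with
  | zero => simpa using derivSeries_mul_C k
  | succ j ih =>
    have hc : (X : PowerSeries (Module.End ℂ Lam)) ^ (k + 1) * derivSeries =
        derivSeries * X ^ (k + 1) := ((commute_X_pow derivSeries (k + 1)).eq).symm
    rw [pow_succ derivSeries (j + 1), mul_assoc, derivSeries_mul_C, mul_sub, ← mul_assoc, ih,
      sub_mul, smul_mul_assoc, mul_assoc (derivSeries ^ j), hc, ← mul_assoc, ← pow_succ,
      succ_nsmul _ (j + 1), mul_assoc]
    abel

/-- With `D` the derivation series in `u`, this is the coefficient of `uᵇ` in `exp(D) p = (p -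
u^(k+1)) exp(D)`, where `p = X k`. -/
theorem expCoeff_derivSeries_X_mul (b k : ℕ) (f : Lam) :
    expCoeff derivSeries b (MvPolynomial.X k * f) =
      MvPolynomial.X k * expCoeff derivSeries b f -
        if k + 1 ≤ b then expCoeff derivSeries (b - (k + 1)) f else 0 := by
  have key : ∀ j, (coeff b (derivSeries ^ (j + 1)) : Module.End ℂ Lam) (MvPolynomial.X k * f) =
      MvPolynomial.X k * (coeff b (derivSeries ^ (j + 1)) : Module.End ℂ Lam) f -
        ((j + 1 : ℕ) : ℂ) • (if k + 1 ≤ b then (coeff (b - (k + 1)) (derivSeries ^ j) : Module.End ℂ Lam) f else 0) := by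
    intro j
    have h := congrArg (fun G => (coeff b G : Module.End ℂ Lam) f) (derivSeries_pow_mul_C k j)
    simp only [map_sub, coeff_mul_C, coeff_C_mul, map_nsmul, coeff_mul_X_pow'] at h
    rw [Nat.cast_smul_eq_nsmul]
    split_ifs at h ⊢ <;> simpa [add_mul] using h
  rw [expCoeff_eq_sum_range coeff_zero_derivSeries (show b < b + 1 + 1 by omega),
    LinearMap.sum_apply, LinearMap.sum_apply, Finset.sum_range_succ', Finset.sum_range_succ' _ (b + 1)]
  simp only [LinearMap.smul_apply, key, smul_sub, Finset.sum_sub_distrib, mul_add, Finset.mul_sum,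
    inv_factorial_succ_smul_succ_smul, mul_smul_comm]
  have h0 : (coeff b (derivSeries ^ 0) : Module.End ℂ Lam) (MvPolynomial.X k * f) =
      MvPolynomial.X k * (coeff b (derivSeries ^ 0) : Module.End ℂ Lam) f := by
    rw [pow_zero, coeff_one]
    split_ifs <;> simp
  rw [h0]
  have h1 : (∑ j ∈ Finset.range (b + 1), ((Nat.factorial j : ℂ)⁻¹) •
      (if k + 1 ≤ b then (coeff (b - (k + 1)) (derivSeries ^ j) : Module.End ℂ Lam) f else 0)) =
      if k + 1 ≤ b then expCoeff derivSeries (b - (k + 1)) f else 0 := by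
    split_ifs with h
    · rw [expCoeff_eq_sum_range coeff_zero_derivSeries (show b - (k + 1) < b + 1 by omega),
        LinearMap.sum_apply]
      rfl
    · simp
  rw [h1]
  abel

theorem expCoeff_derivSeries_C (b : ℕ) (c : ℂ) :
    expCoeff derivSeries b (MvPolynomial.C c) = if b = 0 then MvPolynomial.C c else 0 := by
  have key : ∀ j, (coeff b (derivSeries ^ (j + 1)) : Module.End ℂ Lam) (MvPolynomial.C c : Lam) = 0 := by
    intro j
    rw [pow_succ, coeff_mul, LinearMap.sum_apply]
    refine Finset.sum_eq_zero fun p _ => ?_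
    have : coeff p.2 derivSeries (MvPolynomial.C c : Lam) = 0 := by
      cases hp : p.2 <;> simp [derivSeries]
    rw [Module.End.mul_apply, this, map_zero]
  rw [expCoeff, LinearMap.sum_apply, Finset.sum_range_succ']
  simp only [LinearMap.smul_apply, key, pow_zero, coeff_one]
  split_ifs <;> simp

/-- Taylor's formula: `exp(-∑ xᵏ ∂/∂p_k)` is the substitution `p_k ↦ p_k - xᵏ`. -/
theorem exists_sum_expCoeff_derivSeries {A : Type} [CommRing A] [Algebra ℂ A] (φ : Lam →ₐ[ℂ] A)
    (x : A) (f : Lam) :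
    ∃ d, ∀ N, d ≤ N → ∑ b ∈ Finset.range N, x ^ b * φ (expCoeff derivSeries b f) =
      MvPolynomial.aeval (fun k => φ (MvPolynomial.X k) - x ^ (k + 1)) f := by
  induction f using MvPolynomial.induction_on with
  | C c =>
    refine ⟨1, fun N hN => ?_⟩
    obtain ⟨N, rfl⟩ : ∃ m, N = m + 1 := ⟨N - 1, by omega⟩
    rw [Finset.sum_range_succ']
    have : φ (MvPolynomial.C c) = algebraMap ℂ A c := φ.commutes c
    simp [expCoeff_derivSeries_C, this]
  | add f g hf hg =>
    obtain ⟨d, hd⟩ := hf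
    obtain ⟨e, he⟩ := hg
    refine ⟨max d e, fun N hN => ?_⟩
    simp only [map_add, mul_add, Finset.sum_add_distrib]
    rw [hd N (by omega), he N (by omega)]
  | mul_X f k hf =>
    obtain ⟨d, hd⟩ := hf
    refine ⟨d + (k + 1), fun N hN => ?_⟩
    obtain ⟨N, rfl⟩ : ∃ m, N = m + (k + 1) := ⟨N - (k + 1), by omega⟩
    simp only [mul_comm f, expCoeff_derivSeries_X_mul, map_sub, map_mul, mul_sub,
      Finset.sum_sub_distrib, MvPolynomial.aeval_X, sub_mul]
    congr 1
    · rw [← hd (N + (k + 1)) (by omega), Finset.mul_sum]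
      exact Finset.sum_congr rfl fun b _ => by ring
    -- The first `k + 1` terms vanish and the others are shifted by `k + 1`; the threshold was
    -- raised by `k + 1` so that the shifted range still reaches `d`.
    · rw [← hd N (by omega), add_comm N, Finset.sum_range_add, Finset.sum_eq_zero, zero_add,
        Finset.mul_sum]
      · refine Finset.sum_congr rfl fun b _ => ?_
        rw [if_pos (by omega), Nat.add_sub_cancel_left]
        ring
      · intro b hb
        rw [Finset.mem_range] at hb
        rw [if_neg (by omega), map_zero, mul_zero]

/-! ### Divided differences of powers -/

section DividedDifferences

variable {K : Type} [Field K] [DecidableEq K]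

/-- The divided differences `∑_{x ∈ S} xᵏ / ∏_{y ∈ S, y ≠ x} (x - y)`. -/
def dividedPow (S : Finset K) (k : ℕ) : K := ∑ x ∈ S, x ^ k / ∏ y ∈ S.erase x, (x - y)

theorem prod_erase_sub_ne_zero (S : Finset K) (x : K) : ∏ y ∈ S.erase x, (x - y) ≠ 0 :=
  Finset.prod_ne_zero_iff.2 fun _ hy => sub_ne_zero.2 (Finset.ne_of_mem_erase hy).symm

/-- Below degree `|S|` a power is its own Lagrange interpolant on `S`, and the divided difference is
the coefficient of degree `|S| - 1`. -/
theorem dividedPow_eq_coeff {S : Finset K} {k : ℕ} (h : k < S.card) :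
    dividedPow S k = if k + 1 = S.card then 1 else 0 := by
  have h1 := Lagrange.coeff_eq_sum (s := S) (v := id) Function.injective_id.injOn
    (P := Polynomial.X ^ k) (by rw [Polynomial.degree_X_pow]; exact_mod_cast h)
  simp only [id, Polynomial.eval_pow, Polynomial.eval_X, Polynomial.coeff_X_pow] at h1
  rw [dividedPow, ← h1]
  exact if_congr (by omega) rfl rfl

/-- The factor `x - y` in `x^(k+1) - y * x^k` kills the term at `y` and cancels one factor of every
other denominator. -/
theorem dividedPow_insert_succ {S : Finset K} {y : K} (hy : y ∉ S) (k : ℕ) :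
    dividedPow (insert y S) (k + 1) = y * dividedPow (insert y S) k + dividedPow S k := by
  rw [← sub_eq_iff_eq_add', dividedPow, dividedPow, Finset.mul_sum, ← Finset.sum_sub_distrib,
    Finset.sum_insert hy]
  have h0 : y ^ (k + 1) / (∏ z ∈ (insert y S).erase y, (y - z)) -
      y * (y ^ k / (∏ z ∈ (insert y S).erase y, (y - z))) = 0 := by ring
  rw [h0, zero_add]
  refine Finset.sum_congr rfl fun x hx => ?_
  have hxy : x ≠ y := fun h => hy (h ▸ hx)
  have h1 : (insert y S).erase x = insert y (S.erase x) := Finset.erase_insert_of_ne hxy.symm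
  have h2 : x - y ≠ 0 := sub_ne_zero.2 hxy
  have h3 := prod_erase_sub_ne_zero S x
  rw [h1, Finset.prod_insert (fun h => hy (Finset.mem_of_mem_erase h))]
  field_simp
  ring

end DividedDifferences

/-! ### Values of symmetric functions on finite sets -/

section Evaluation

variable {K : Type} [Field K] [Algebra ℂ K]

/-- The evaluation of symmetric functions at a finite set of elements of a field. -/
def evalSet (S : Finset K) : Lam →ₐ[ℂ] K :=
  MvPolynomial.aeval fun k => ∑ x ∈ S, x ^ (k + 1)

theorem evalSet_X (S : Finset K) (k : ℕ) :
    evalSet S (MvPolynomial.X k) = ∑ x ∈ S, x ^ (k + 1) := by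
  simp [evalSet]

theorem evalSet_empty_hsymFun_succ (m : ℕ) : evalSet (∅ : Finset K) (hsymFun (m + 1)) = 0 := by
  rw [map_hsymFun]
  have h : (powerSumSeries fun k => evalSet (∅ : Finset K) (MvPolynomial.X k)) = 0 := by
    ext n
    cases n <;> simp [powerSumSeries, evalSet_X]
  rw [h, expCoeff]
  refine Finset.sum_eq_zero fun j _ => ?_
  cases j <;> simp [coeff_one]

variable [DecidableEq K]

/-- This is the product formula `∏ 1 / (1 - x t)` for the generating series of the `h_m`, one factor
at a time. Both sides have constant term `1` and the same logarithmic derivative. -/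
theorem expSeries_insert {S : Finset K} {y : K} (hy : y ∉ S) :
    (1 - C y * X) * expSeries (powerSumSeries fun k => ∑ x ∈ insert y S, x ^ (k + 1)) =
      expSeries (powerSumSeries fun k => ∑ x ∈ S, x ^ (k + 1)) := by
  have : CharZero K := charZero_of_injective_algebraMap (algebraMap ℂ K).injective
  have hgeom : (1 - C y * X) * (PowerSeries.mk fun k => y ^ (k + 1)) = C y := by
    ext n
    rw [sub_mul, one_mul, map_sub, mul_assoc, coeff_C_mul]
    cases n with
    | zero => simp
    | succ n =>
      rw [coeff_succ_X_mul, coeff_mk, coeff_mk, coeff_C, if_neg (by omega)]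
      ring
  have hsum : (PowerSeries.mk fun k => ∑ x ∈ insert y S, x ^ (k + 1)) =
      (PowerSeries.mk fun k => y ^ (k + 1)) + PowerSeries.mk fun k => ∑ x ∈ S, x ^ (k + 1) := by
    ext n
    simp [Finset.sum_insert hy]
  refine eq_of_derivative_eq_mul (W := PowerSeries.mk fun k => ∑ x ∈ S, x ^ (k + 1)) ?_ ?_ ?_
  · rw [Derivation.leibniz, derivative_expSeries (coeff_zero_powerSumSeries _),
      derivative_powerSumSeries, hsum]
    have h1 : derivative K (1 - C y * X : PowerSeries K) = -C y := by
      rw [map_sub, derivative_one, Derivation.leibniz, derivative_C, derivative_X]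
      simp
    rw [h1]
    simp only [smul_eq_mul]
    linear_combination
      expSeries (powerSumSeries fun k => ∑ x ∈ insert y S, x ^ (k + 1)) * hgeom
  · rw [derivative_expSeries (coeff_zero_powerSumSeries _), derivative_powerSumSeries]
  · rw [sub_mul, one_mul, map_sub, mul_assoc, coeff_C_mul]
    simp [expSeries, expCoeff_zero]

theorem evalSet_hsymFun_insert_succ {S : Finset K} {y : K} (hy : y ∉ S) (m : ℕ) :
    evalSet (insert y S) (hsymFun (m + 1)) =
      y * evalSet (insert y S) (hsymFun m) + evalSet S (hsymFun (m + 1)) := by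
  have h := congrArg (coeff (m + 1)) (expSeries_insert hy)
  rw [sub_mul, one_mul, map_sub, mul_assoc, coeff_C_mul, coeff_succ_X_mul] at h
  simp only [expSeries, coeff_mk] at h
  simp only [map_hsymFun, evalSet_X]
  linear_combination h

/-- Both sides satisfy the same recursion when an element is inserted into `S`. -/
theorem evalSet_hsymFun (S : Finset K) {m k : ℕ} (h : k + 1 = m + S.card) :
    evalSet S (hsymFun m) = dividedPow S k := by
  induction S using Finset.induction_on generalizing m k with
  | empty =>
    obtain rfl : m = k + 1 := by simpa using h.symm
    rw [evalSet_empty_hsymFun_succ]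
    simp [dividedPow]
  | insert y S hy ihS =>
    induction m generalizing k with
    | zero =>
      rw [dividedPow_eq_coeff (by omega), if_pos (by omega), hsymFun, expCoeff_zero, map_one]
    | succ m ih =>
      rw [Finset.card_insert_of_notMem hy] at h ih
      obtain ⟨k, rfl⟩ : ∃ j, k = j + 1 := ⟨k - 1, by omega⟩
      rw [evalSet_hsymFun_insert_succ hy, dividedPow_insert_succ hy, ih (k := k) (by omega),
        ihS (k := k) (by omega)]

end Evaluation

/-! ### Values of Bernstein operators -/

theorem exists_bernstein_eq_sum (n : ℤ) (f : Lam) :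
    ∃ d, ∀ N, d ≤ N → bernstein n f = ∑ b ∈ Finset.range N,
      if 0 ≤ n + b then hsymFun (n + b).toNat * expCoeff derivSeries b f else 0 := by
  obtain ⟨d, hd⟩ := exists_derivCoeff_eq_zero f
  refine ⟨d, fun N hN => ?_⟩
  rw [← Finset.sum_filter]
  have hinj : Set.InjOn (fun b : ℕ => ((n + b).toNat, b))
      ((Finset.range N).filter fun b : ℕ => 0 ≤ n + b) := fun a _ b _ h => (Prod.ext_iff.1 h).2
  have h := Finset.sum_image (f := fun ab : ℕ × ℕ =>
    expCoeff multSeries ab.1 (expCoeff derivSeries ab.2 f)) hinj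
  simp only [expCoeff_multSeries] at h
  rw [← h]
  change (∑ᶠ (ab : ℕ × ℕ) (_ : ab ∈ {ab : ℕ × ℕ | (ab.1 : ℤ) - ab.2 = n}),
    expCoeff multSeries ab.1 (expCoeff derivSeries ab.2 f)) = _
  simp only [expCoeff_multSeries]
  refine finsum_mem_eq_sum_of_inter_support_eq _ ?_
  ext ⟨a, b⟩
  simp only [Set.mem_inter_iff, Set.mem_ofPred_eq, Finset.coe_image, Finset.coe_filter,
    Finset.mem_range, Set.mem_image, Prod.mk.injEq, Function.mem_support]
  refine and_congr_left fun hab => ?_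
  have hb : b < d := by
    by_contra hb
    exact hab (by simp [hd b (not_lt.1 hb)])
  constructor
  · intro h
    exact ⟨b, ⟨by omega, by omega⟩, by omega, rfl⟩
  · rintro ⟨b', ⟨_, _⟩, h3, rfl⟩
    omega

/-- Bernstein operators add a variable: the value of `B_n f` on `S` is a divided difference of
the values of `f` on the sets `S \ {x}`. -/
theorem evalSet_bernstein {K : Type} [Field K] [Algebra ℂ K] [DecidableEq K] (S : Finset K) {n : ℤ}
    {e : ℕ} (he : (e : ℤ) + 1 = n + S.card) (f : Lam) :
    evalSet S (bernstein n f) =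
      ∑ x ∈ S, x ^ e / (∏ y ∈ S.erase x, (x - y)) * evalSet (S.erase x) f := by
  obtain ⟨d, hd⟩ := exists_bernstein_eq_sum n f
  have hT := fun x => exists_sum_expCoeff_derivSeries (evalSet S) x f
  choose D hD using hT
  set N := max d (S.sup D) with hN
  have hx : ∀ x ∈ S, evalSet (S.erase x) f =
      ∑ b ∈ Finset.range N, x ^ b * evalSet S (expCoeff derivSeries b f) := by
    intro x hx
    rw [hD x N (le_trans (Finset.le_sup hx) (le_max_right _ _)), evalSet]
    congr 2
    ext k
    rw [evalSet_X, Finset.sum_erase_eq_sub hx]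
  have hsum : (∑ x ∈ S, x ^ e / (∏ y ∈ S.erase x, (x - y)) * evalSet (S.erase x) f) =
      ∑ x ∈ S, ∑ b ∈ Finset.range N, x ^ e / (∏ y ∈ S.erase x, (x - y)) *
        (x ^ b * evalSet S (expCoeff derivSeries b f)) :=
    Finset.sum_congr rfl fun x h => by rw [hx x h, Finset.mul_sum]
  rw [hsum, hd N (le_max_left _ _), map_sum]
  rw [Finset.sum_comm]
  refine Finset.sum_congr rfl fun b _ => ?_
  have h1 : ∑ x ∈ S, x ^ e / (∏ y ∈ S.erase x, (x - y)) *
      (x ^ b * evalSet S (expCoeff derivSeries b f)) =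
      dividedPow S (e + b) * evalSet S (expCoeff derivSeries b f) := by
    rw [dividedPow, Finset.sum_mul]
    refine Finset.sum_congr rfl fun x _ => ?_
    rw [pow_add]
    ring
  rw [h1]
  split_ifs with h
  · rw [map_mul, evalSet_hsymFun S (k := e + b) (by omega)]
  -- If `n + b < 0`, the operator has no such term; correspondingly `e + b + 1 < |S|`, where the
  -- divided difference vanishes.
  · rw [dividedPow_eq_coeff (by omega), if_neg (by omega), map_zero, zero_mul]

/-! ### Symmetric functions are determined by their values -/

/-- This is the chain rule. The bound depends only on the power sums occurring in `f`, not on the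
number of variables. -/
theorem exists_pderiv_restrict_eq_sum (f : Lam) :
    ∃ d, ∀ M, d ≤ M → ∀ (N : ℕ) (i : Fin N), MvPolynomial.pderiv i (restrict N f) =
      ∑ k ∈ Finset.range M, (((k + 1 : ℕ) : MvPolynomial (Fin N) ℂ) *
        restrict N (MvPolynomial.pderiv k f)) * MvPolynomial.X i ^ k := by
  induction f using MvPolynomial.induction_on with
  | C c =>
    refine ⟨0, fun M _ N i => ?_⟩
    have : restrict N (MvPolynomial.C c) = MvPolynomial.C c := (restrict N).commutes c
    simp [this]
  | add f g hf hg =>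
    obtain ⟨d, hd⟩ := hf
    obtain ⟨e, he⟩ := hg
    refine ⟨max d e, fun M hM N i => ?_⟩
    simp only [map_add, mul_add, add_mul, Finset.sum_add_distrib]
    rw [hd M (by omega), he M (by omega)]
  | mul_X f m hf =>
    obtain ⟨d, hd⟩ := hf
    refine ⟨max d (m + 1), fun M hM N i => ?_⟩
    have hp : MvPolynomial.pderiv i (restrict N (MvPolynomial.X m)) =
        ((m + 1 : ℕ) : MvPolynomial (Fin N) ℂ) * MvPolynomial.X i ^ m := by
      rw [restrict, MvPolynomial.aeval_X, MvPolynomial.psum, map_sum,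
        Finset.sum_eq_single i]
      · rw [MvPolynomial.pderiv_pow, MvPolynomial.pderiv_X_self]
        simp
      · intro j _ hj
        rw [MvPolynomial.pderiv_pow, MvPolynomial.pderiv_X_of_ne hj, mul_zero]
      · simp
    simp only [Derivation.leibniz, map_mul, hd M (by omega) N i, hp, smul_eq_mul, map_add, mul_add,
      add_mul, Finset.sum_add_distrib]
    congr 1
    · rw [Finset.sum_eq_single m]
      · rw [MvPolynomial.pderiv_X_self, map_one]
        ring
      · intro k _ hk
        rw [MvPolynomial.pderiv_X_of_ne hk.symm]
        simp
      · intro h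
        exact absurd (Finset.mem_range.2 (by omega)) h
    · rw [Finset.mul_sum]
      exact Finset.sum_congr rfl fun k _ => by ring

/-- The power sums are algebraically independent: a symmetric function that vanishes in every large
number of variables is zero. -/
theorem eq_zero_of_restrict_eq_zero {f : Lam} {N₀ : ℕ} (h : ∀ N, N₀ ≤ N → restrict N f = 0) :
    f = 0 := by
  obtain ⟨d, hd⟩ := exists_mem_degLT f
  induction d using Nat.strong_induction_on generalizing f N₀ with
  | _ d ih =>
    rcases Nat.eq_zero_or_pos d with rfl | hd0
    · exact eq_zero_of_mem_degLT_zero hd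
    have hderiv : ∀ k, MvPolynomial.pderiv k f = 0 := by
      intro k
      have hk : MvPolynomial.pderiv k f ∈ degLT (d - (k + 1)) := by
        have h1 := derivSeries_mem (k + 1) hd
        simp only [derivSeries, PowerSeries.coeff_mk, LinearMap.neg_apply] at h1
        exact (Submodule.neg_mem_iff _).1 h1
      obtain ⟨D, hD⟩ := exists_pderiv_restrict_eq_sum f
      refine ih (d - (k + 1)) (by omega) (N₀ := max N₀ (max D (k + 1))) (fun N hN => ?_) hk
      set c : ℕ → MvPolynomial (Fin N) ℂ := fun j =>
        ((j + 1 : ℕ) : MvPolynomial (Fin N) ℂ) * restrict N (MvPolynomial.pderiv j f) with hc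
      -- By the chain rule `Q` vanishes at the `N` distinct variables. Its degree is less than `N`,
      -- so each coefficient is zero, in particular the one at `k < N`.
      set Q : Polynomial (MvPolynomial (Fin N) ℂ) :=
        ∑ j ∈ Finset.range N, Polynomial.C (c j) * Polynomial.X ^ j with hQ
      have hQ0 : Q = 0 := by
        refine Polynomial.eq_zero_of_natDegree_lt_card_of_eval_eq_zero Q
          (MvPolynomial.X_injective (σ := Fin N) (R := ℂ)) (fun i => ?_) ?_
        · rw [hQ, Polynomial.eval_finsetSum]
          simp only [Polynomial.eval_mul, Polynomial.eval_C, Polynomial.eval_pow, Polynomial.eval_X]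
          rw [← hD N (by omega) N i, h N (by omega), map_zero]
        · rw [Fintype.card_fin]
          have h2 : Q.natDegree ≤ N - 1 := by
            refine Polynomial.natDegree_sum_le_of_forall_le _ _ fun j hj => ?_
            have := Finset.mem_range.1 hj
            exact (Polynomial.natDegree_C_mul_X_pow_le _ _).trans (by omega)
          omega
      have h3 := congrArg (fun P => Polynomial.coeff P k) hQ0
      simp only [hQ, Polynomial.finsetSum_coeff, Polynomial.coeff_C_mul, Polynomial.coeff_X_pow,
        mul_ite, mul_one, mul_zero, Finset.sum_ite_eq, Finset.mem_range, Polynomial.coeff_zero] at h3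
      rw [if_pos (by omega)] at h3
      exact (mul_eq_zero.1 h3).resolve_left (Nat.cast_ne_zero.2 (by omega))
    have hcoeff : ∀ m, m ≠ 0 → f.coeff m = 0 := by
      intro m hm
      obtain ⟨i, hi⟩ := Finsupp.ne_iff.1 hm
      have h1 := MvPolynomial.coeff_pderiv (i := i) f (m - Finsupp.single i 1)
      rw [hderiv i, MvPolynomial.coeff_zero, tsub_add_cancel_of_le] at h1
      · exact (mul_eq_zero.1 h1.symm).resolve_right (Nat.cast_add_one_ne_zero _)
      · exact Finsupp.single_le_iff.2 (Nat.one_le_iff_ne_zero.2 hi)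
    have hf : f = MvPolynomial.C (f.coeff 0) := by
      ext m
      rw [MvPolynomial.coeff_C]
      split_ifs with h0
      · rw [h0]
      · exact hcoeff m (Ne.symm h0)
    have h4 := h N₀ le_rfl
    rw [hf] at h4 ⊢
    have h5 : restrict N₀ (MvPolynomial.C (f.coeff 0)) = MvPolynomial.C (f.coeff 0) :=
      (restrict N₀).commutes _
    rw [h5, MvPolynomial.C_eq_zero] at h4
    rw [h4, map_zero]

theorem algHom_restrict_eq_evalSet {K : Type} [Field K] [Algebra ℂ K] [DecidableEq K] {N : ℕ}
    (φ : MvPolynomial (Fin N) ℂ →ₐ[ℂ] K) (hφ : Function.Injective fun i => φ (MvPolynomial.X i))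
    (f : Lam) :
    φ (restrict N f) = evalSet (Finset.univ.image fun i => φ (MvPolynomial.X i)) f := by
  have h : φ.comp (restrict N) =
      evalSet (Finset.univ.image fun i => φ (MvPolynomial.X i)) := by
    ext k
    rw [evalSet_X, Finset.sum_image hφ.injOn]
    simp [restrict, MvPolynomial.psum]
  exact DFunLike.congr_fun h f

theorem eq_zero_of_evalSet_eq_zero {f : Lam} {N₀ : ℕ}
    (h : ∀ S : Finset ℂ, N₀ ≤ S.card → evalSet S f = 0) : f = 0 := by
  refine eq_zero_of_restrict_eq_zero (N₀ := N₀) fun N hN => ?_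
  -- `V` vanishes wherever two coordinates coincide, so its product with the restriction vanishes on
  -- all of `ℂ^N`.
  set V : MvPolynomial (Fin N) ℂ :=
    ∏ i, ∏ j ∈ Finset.univ.erase i, (MvPolynomial.X i - MvPolynomial.X j) with hV
  have hV0 : V ≠ 0 := by
    refine Finset.prod_ne_zero_iff.2 fun i _ => Finset.prod_ne_zero_iff.2 fun j hj => ?_
    exact sub_ne_zero.2 fun hij =>
      Finset.ne_of_mem_erase hj (MvPolynomial.X_injective hij).symm
  refine (mul_eq_zero.1 (?_ : restrict N f * V = 0)).resolve_right hV0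
  refine MvPolynomial.funext fun x => ?_
  rw [map_mul, map_zero]
  by_cases hx : Function.Injective x
  · have h1 := algHom_restrict_eq_evalSet (MvPolynomial.aeval x) (by simpa using hx) f
    rw [h] at h1
    · rw [MvPolynomial.aeval_eq_eval] at h1
      exact mul_eq_zero_of_left h1 _
    · simp only [MvPolynomial.aeval_X]
      rw [Finset.card_image_of_injective _ hx]
      simpa using hN
  · obtain ⟨i, j, hij, hne⟩ : ∃ i j, x i = x j ∧ i ≠ j := by
      simpa [Function.Injective] using hx
    refine mul_eq_zero_of_right _ ?_
    rw [hV, map_prod]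
    refine Finset.prod_eq_zero (Finset.mem_univ i) ?_
    rw [map_prod]
    refine Finset.prod_eq_zero (Finset.mem_erase.2 ⟨hne.symm, Finset.mem_univ j⟩) ?_
    simp [hij]

/-! ### Straightening and antisymmetry of Bernstein operators -/

/-- Exchanging `x` and `y` changes the denominator only by turning the factor `x - y` into `y - x`.
-/
theorem sum_sum_erase_antisymm {K : Type} [Field K] [DecidableEq K] (S : Finset K) (a b : ℕ)
    (F : Finset K → K) :
    ∑ x ∈ S, x ^ a / (∏ z ∈ S.erase x, (x - z)) * ∑ y ∈ S.erase x,
        y ^ b / (∏ z ∈ (S.erase x).erase y, (y - z)) * F ((S.erase x).erase y) =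
      -∑ x ∈ S, x ^ b / (∏ z ∈ S.erase x, (x - z)) * ∑ y ∈ S.erase x,
        y ^ a / (∏ z ∈ (S.erase x).erase y, (y - z)) * F ((S.erase x).erase y) := by
  simp only [Finset.mul_sum, ← Finset.sum_neg_distrib]
  rw [Finset.sum_comm' (s := S) (t := fun x => S.erase x) (t' := S) (s' := fun x => S.erase x)
    (by
      intro x y
      simp only [Finset.mem_erase]
      constructor
      · rintro ⟨h1, h2, h3⟩
        exact ⟨⟨Ne.symm h2, h1⟩, h3⟩
      · rintro ⟨⟨h1, h2⟩, h3⟩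
        exact ⟨h2, Ne.symm h1, h3⟩)]
  refine Finset.sum_congr rfl fun x hx => Finset.sum_congr rfl fun y hy => ?_
  have hxy : y ≠ x := Finset.ne_of_mem_erase hy
  have hxy' : x - y ≠ 0 := sub_ne_zero.2 hxy.symm
  have hyx' : y - x ≠ 0 := sub_ne_zero.2 hxy
  have e1 : (S.erase y).erase x = (S.erase x).erase y := Finset.erase_right_comm
  have hx' : x ∈ S.erase y := Finset.mem_erase.2 ⟨hxy.symm, hx⟩
  rw [← Finset.mul_prod_erase (S.erase y) (fun z => y - z) hx',
    ← Finset.mul_prod_erase (S.erase x) (fun z => x - z) hy, e1]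
  have h1 : ∏ z ∈ (S.erase x).erase y, (x - z) ≠ 0 := by
    rw [← e1]; exact prod_erase_sub_ne_zero _ _
  have h2 : ∏ z ∈ (S.erase x).erase y, (y - z) ≠ 0 := prod_erase_sub_ne_zero _ _
  field_simp
  ring

theorem evalSet_bernstein_bernstein {K : Type} [Field K] [Algebra ℂ K] [DecidableEq K]
    (S : Finset K) {m n : ℤ} {a b : ℕ} (ha : (a : ℤ) + 1 = m + S.card)
    (hb : (b : ℤ) + 2 = n + S.card) (f : Lam) :
    evalSet S (bernstein m (bernstein n f)) =
      ∑ x ∈ S, x ^ a / (∏ z ∈ S.erase x, (x - z)) * ∑ y ∈ S.erase x,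
        y ^ b / (∏ z ∈ (S.erase x).erase y, (y - z)) * evalSet ((S.erase x).erase y) f := by
  rw [evalSet_bernstein S ha]
  refine Finset.sum_congr rfl fun x hx => ?_
  have h : (((S.erase x).card : ℕ) : ℤ) + 1 = S.card := by
    exact_mod_cast Finset.card_erase_add_one hx
  rw [evalSet_bernstein (S.erase x) (e := b) (by omega)]

/-- The straightening rule for Bernstein operators. -/
theorem bernstein_mul_bernstein (m n : ℤ) :
    bernstein m * bernstein n = -(bernstein (n - 1) * bernstein (m + 1)) := by
  refine LinearMap.ext fun f => ?_
  rw [← sub_eq_zero]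
  -- The bound on `|S|` makes both exponents `m + |S| - 1` and `n + |S| - 2` nonnegative. Passing
  -- from `(m, n)` to `(n - 1, m + 1)` swaps them.
  refine eq_zero_of_evalSet_eq_zero (N₀ := m.natAbs + n.natAbs + 3) fun S hS => ?_
  obtain ⟨a, ha⟩ : ∃ a : ℕ, (a : ℤ) + 1 = m + S.card := ⟨(m + S.card - 1).toNat, by omega⟩
  obtain ⟨b, hb⟩ : ∃ b : ℕ, (b : ℤ) + 2 = n + S.card := ⟨(n + S.card - 2).toNat, by omega⟩
  rw [map_sub, LinearMap.neg_apply, map_neg, Module.End.mul_apply, Module.End.mul_apply,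
    evalSet_bernstein_bernstein S ha hb,
    evalSet_bernstein_bernstein S (a := b) (b := a) (by omega) (by omega),
    sum_sum_erase_antisymm S a b fun T => evalSet T f, sub_self]

theorem bernsteinComp_succ {l : ℕ} (μ : Fin (l + 1) → ℤ) :
    bernsteinComp μ = bernstein (μ 0) * bernsteinComp fun i => μ i.succ := by
  rw [bernsteinComp, List.ofFn_succ, List.prod_cons, bernsteinComp]

theorem bernsteinComp_adjacent {n : ℕ} (μ ν : Fin (n + 1) → ℤ) (i : Fin n)
    (h : ∀ j, j ≠ i.castSucc → j ≠ i.succ → ν j = μ j) (h1 : ν i.castSucc = μ i.succ - 1)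
    (h2 : ν i.succ = μ i.castSucc + 1) : bernsteinComp ν = -bernsteinComp μ := by
  induction n with
  | zero => exact i.elim0
  | succ n ih =>
    refine Fin.cases ?_ (fun k => ?_) i (motive := fun i =>
      (∀ j, j ≠ i.castSucc → j ≠ i.succ → ν j = μ j) → ν i.castSucc = μ i.succ - 1 →
      ν i.succ = μ i.castSucc + 1 → bernsteinComp ν = -bernsteinComp μ) h h1 h2
    · intro h h1 h2
      have h3 : (fun j : Fin n => ν j.succ.succ) = fun j => μ j.succ.succ := by
        funext j
        refine h _ (Fin.succ_ne_zero _) fun hj => ?_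
        exact Fin.succ_ne_zero j (Fin.succ_injective _ hj)
      rw [bernsteinComp_succ ν, bernsteinComp_succ μ, bernsteinComp_succ, bernsteinComp_succ, h3,
        ← mul_assoc, ← mul_assoc]
      refine Eq.trans ?_ (LinearMap.neg_comp _ _)
      rw [bernstein_mul_bernstein (μ 0), neg_neg]
      exact congrArg₂ (fun a b => bernstein a * bernstein b * _) h1 h2
    · intro h h1 h2
      rw [bernsteinComp_succ ν, bernsteinComp_succ μ,
        h 0 (by simpa using (Fin.succ_ne_zero k.castSucc).symm) (Fin.succ_ne_zero _).symm,
        ih (fun j => μ j.succ) (fun j => ν j.succ) k (fun j hj hj' => h _ ?_ ?_) ?_ ?_]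
      · exact LinearMap.comp_neg _ _
      · simpa using h1
      · simpa using h2
      · rw [← Fin.succ_castSucc]
        exact fun hh => hj (Fin.succ_injective _ hh)
      · exact fun hh => hj' (Fin.succ_injective _ hh)

/-- The composition of Bernstein operators with index `e - δ`. -/
def bernsteinExp {l : ℕ} (e : Fin l → ℕ) : Module.End ℂ Lam :=
  bernsteinComp fun i => (e i : ℤ) - delta l i

/-- Since `δ` drops by one at each step, the straightening rule becomes a plain transposition of the
shifted indices. -/
theorem bernsteinExp_comp_swap {n : ℕ} (e : Fin (n + 1) → ℕ) (i : Fin n) :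
    bernsteinExp (e ∘ Equiv.swap i.castSucc i.succ) = -bernsteinExp e := by
  refine bernsteinComp_adjacent _ _ i (fun j h1 h2 => ?_) ?_ ?_
  · simp [Equiv.swap_apply_of_ne_of_ne h1 h2]
  · simp only [Function.comp, Equiv.swap_apply_left, delta, Fin.val_castSucc, Fin.val_succ]
    omega
  · simp only [Function.comp, Equiv.swap_apply_right, delta, Fin.val_castSucc, Fin.val_succ]
    omega

/-- Bernstein operators are antisymmetric in the shifted indices. -/
theorem bernsteinExp_comp_perm {l : ℕ} (e : Fin l → ℕ) (σ : Equiv.Perm (Fin l)) :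
    bernsteinExp (e ∘ σ) = ((Equiv.Perm.sign σ : ℤˣ) : ℤ) • bernsteinExp e := by
  cases l with
  | zero =>
    rw [Subsingleton.elim σ 1]
    simp
  | succ n =>
    have hσ : σ ∈ Submonoid.closure
        (Set.range fun i : Fin n => Equiv.swap i.castSucc i.succ) := by
      rw [Equiv.Perm.mclosure_swap_castSucc_succ]
      trivial
    induction hσ using Submonoid.closure_induction generalizing e with
    | mem x hx =>
      obtain ⟨i, rfl⟩ := hx
      simp only [bernsteinExp_comp_swap, Equiv.Perm.sign_swap (Fin.castSucc_lt_succ (i := i)).ne,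
        Units.val_neg, Units.val_one, neg_smul, one_smul]
    | one => simp
    | mul x y _ _ hx hy =>
      rw [Equiv.Perm.coe_mul, ← Function.comp_assoc, hy, hx, smul_smul, map_mul, Units.val_mul,
        mul_comm]

theorem bernsteinExp_eq_zero {l : ℕ} {e : Fin l → ℕ} (he : ¬ Function.Injective e) :
    bernsteinExp e = 0 := by
  obtain ⟨i, j, hij, hne⟩ : ∃ i j, e i = e j ∧ i ≠ j := by
    simpa [Function.Injective] using he
  have h := bernsteinExp_comp_perm e (Equiv.swap i j)
  have h1 : e ∘ Equiv.swap i j = e := by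
    funext k
    rw [Function.comp, Equiv.swap_apply_def]
    split_ifs with h2 h3
    · rw [h2, hij]
    · rw [h3, hij]
    · rfl
  rw [h1, Equiv.Perm.sign_swap hne, Units.val_neg, Units.val_one, neg_smul, one_smul] at h
  have h2 : (2 : ℂ) • bernsteinExp e = 0 := by
    rw [two_smul]
    nth_rewrite 1 [h]
    exact neg_add_cancel _
  exact (smul_eq_zero.1 h2).resolve_left two_ne_zero

theorem bernsteinComp_eq_bernsteinExp {l : ℕ} (μ : Fin l → ℕ) :
    (bernsteinComp fun i => (μ i : ℤ)) = bernsteinExp (μ + delta l) := by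
  simp [bernsteinExp]

/-! ### Alternants and the bialternant formula -/

section Alternants

variable {R : Type*} [CommRing R]

theorem delta_succ {l : ℕ} (j : Fin l) : delta (l + 1) j.succ = delta l j := by
  simp only [delta, Fin.val_succ]
  omega

theorem det_pow_delta {l : ℕ} (v : Fin l → R) :
    (Matrix.of fun i j => v i ^ delta l j).det = ∏ i, ∏ j ∈ Finset.Ioi i, (v i - v j) := by
  have h : (Matrix.of fun i j => v i ^ delta l j) = Matrix.projVandermonde 1 v := by
    ext i j
    have : delta l j = (j.rev : ℕ) := by
      simp only [delta, Fin.val_rev]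
      omega
    simp [Matrix.projVandermonde_apply, this]
  rw [h, Matrix.det_projVandermonde]
  simp

/-- Row `p` is moved to the top by a cycle of sign `(-1)^p`; the factors of the Vandermonde product
that involve it then split off. -/
theorem det_pow_delta_succAbove {l : ℕ} (v : Fin (l + 1) → R) (p : Fin (l + 1)) :
    (Matrix.of fun i j => v i ^ delta (l + 1) j).det =
      (-1) ^ (p : ℕ) * ((∏ j, (v p - v (p.succAbove j))) *
        (Matrix.of fun i j => v (p.succAbove i) ^ delta l j).det) := by
  have h := Matrix.det_permute p.cycleRange.symm (Matrix.of fun i j => v i ^ delta (l + 1) j)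
  have h1 : (Matrix.of fun i j => v i ^ delta (l + 1) j).submatrix p.cycleRange.symm id =
      Matrix.of fun i j => v (p.cycleRange.symm i) ^ delta (l + 1) j := rfl
  rw [h1, det_pow_delta, Fin.prod_univ_succ, Fin.prod_Ioi_zero] at h
  simp only [Fin.prod_Ioi_succ, Fin.cycleRange_symm_zero, Fin.cycleRange_symm_succ] at h
  rw [det_pow_delta (fun i => v (p.succAbove i)), h, Equiv.Perm.sign_symm, Fin.sign_cycleRange]
  push_cast
  rw [← mul_assoc, ← mul_pow]
  simp

end Alternants

/-- The bialternant formula for the values of `B_μ 1`. -/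
theorem evalSet_bernsteinComp_mul_det {K : Type} [Field K] [Algebra ℂ K] [DecidableEq K] {l : ℕ}
    (v : Fin l → K) (hv : Function.Injective v) (μ : Fin l → ℕ) :
    evalSet (Finset.univ.image v) (bernsteinComp (fun i => (μ i : ℤ)) 1) *
      (Matrix.of fun i j => v i ^ delta l j).det =
      (Matrix.of fun i j => v i ^ (μ + delta l) j).det := by
  induction l with
  | zero => simp [bernsteinComp]
  | succ l ih =>
    have hcard : (Finset.univ.image v).card = l + 1 := by
      rw [Finset.card_image_of_injective _ hv]
      simp
    have herase : ∀ p, (Finset.univ.image v).erase (v p) =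
        Finset.univ.image fun j => v (p.succAbove j) := by
      intro p
      ext x
      simp only [Finset.mem_erase, Finset.mem_image, Finset.mem_univ, true_and]
      constructor
      · rintro ⟨h1, i, rfl⟩
        obtain ⟨j, hj⟩ := Fin.exists_succAbove_eq (x := i) (y := p) fun h => h1 (congrArg v h)
        exact ⟨j, by rw [hj]⟩
      · rintro ⟨j, rfl⟩
        exact ⟨fun h => Fin.succAbove_ne p j (hv h), _, rfl⟩
    have hinj : ∀ p : Fin (l + 1), Function.Injective fun j => v (p.succAbove j) :=
      fun p => hv.comp Fin.succAbove_right_injective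
    -- The sum over the removed element matches the Laplace expansion along the first column, term
    -- by term.
    rw [bernsteinComp_succ, Module.End.mul_apply,
      evalSet_bernstein _ (e := μ 0 + l) (by rw [hcard]; push_cast; ring),
      Finset.sum_image hv.injOn, Finset.sum_mul,
      Matrix.det_succ_column_zero (Matrix.of fun i j => v i ^ (μ + delta (l + 1)) j)]
    refine Finset.sum_congr rfl fun p _ => ?_
    have hsub : (Matrix.of fun i j => v i ^ (μ + delta (l + 1)) j).submatrix p.succAbove Fin.succ =
        Matrix.of fun i j => v (p.succAbove i) ^ ((fun i : Fin l => μ i.succ) + delta l) j := by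
      ext i j
      simp [delta_succ]
    have hprod : ∏ y ∈ (Finset.univ.image v).erase (v p), (v p - y) =
        ∏ j, (v p - v (p.succAbove j)) := by
      rw [herase, Finset.prod_image (hinj p).injOn]
    have hne : ∏ j, (v p - v (p.succAbove j)) ≠ 0 :=
      Finset.prod_ne_zero_iff.2 fun j _ =>
        sub_ne_zero.2 fun h => Fin.succAbove_ne p j (hv h).symm
    rw [hsub, hprod, herase, ← ih _ (hinj p), det_pow_delta_succAbove v p]
    have hd : delta (l + 1) 0 = l := by simp [delta]
    simp only [Matrix.of_apply, Pi.add_apply, hd]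
    field_simp

/-! ### `B_μ 1` and the monomials of alternants -/

/-- The symmetric function `B_μ 1`. -/
def schurB {l : ℕ} (μ : Fin l → ℕ) : Lam := bernsteinComp (fun i => (μ i : ℤ)) 1

theorem alternant_delta_ne_zero (l : ℕ) : alternant (delta l) ≠ 0 := by
  rw [alternant, det_pow_delta]
  refine Finset.prod_ne_zero_iff.2 fun i _ => Finset.prod_ne_zero_iff.2 fun j hj => ?_
  exact sub_ne_zero.2 fun h => (Finset.mem_Ioi.1 hj).ne (MvPolynomial.X_injective h)

theorem algebraMap_eq_schurPoly_iff {l : ℕ} (μ : Fin l → ℕ) (q : MvPolynomial (Fin l) ℂ) :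
    algebraMap (MvPolynomial (Fin l) ℂ) (FractionRing (MvPolynomial (Fin l) ℂ)) q = schurPoly μ ↔
      q * alternant (delta l) = alternant (μ + delta l) := by
  have hinj := IsFractionRing.injective (MvPolynomial (Fin l) ℂ)
    (FractionRing (MvPolynomial (Fin l) ℂ))
  rw [schurPoly, eq_div_iff, ← map_mul, hinj.eq_iff]
  exact (map_ne_zero_iff _ hinj).2 (alternant_delta_ne_zero l)

theorem restrict_schurB_mul {l : ℕ} (μ : Fin l → ℕ) :
    restrict l (schurB μ) * alternant (delta l) = alternant (μ + delta l) := by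
  classical
  set K := FractionRing (MvPolynomial (Fin l) ℂ)
  have hinj : Function.Injective (algebraMap (MvPolynomial (Fin l) ℂ) K) :=
    IsFractionRing.injective _ _
  set φ : MvPolynomial (Fin l) ℂ →ₐ[ℂ] K := IsScalarTower.toAlgHom ℂ _ K
  have hφ : Function.Injective φ := hinj
  have hv : Function.Injective fun i => φ (MvPolynomial.X i) :=
    hφ.comp MvPolynomial.X_injective
  have hdet : ∀ e : Fin l → ℕ,
      φ (alternant e) = (Matrix.of fun i j => φ (MvPolynomial.X i) ^ e j).det := by
    intro e
    rw [alternant, AlgHom.map_det]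
    congr 1
    ext i j
    simp
  apply hφ
  -- The evaluation takes place at the generic point: the variables are distinct elements of the
  -- fraction field.
  rw [map_mul, hdet, hdet, algHom_restrict_eq_evalSet φ hv]
  exact evalSet_bernsteinComp_mul_det _ hv μ

theorem algebraMap_restrict_schurB {l : ℕ} (μ : Fin l → ℕ) :
    algebraMap (MvPolynomial (Fin l) ℂ) (FractionRing (MvPolynomial (Fin l) ℂ))
      (restrict l (schurB μ)) = schurPoly μ :=
  (algebraMap_eq_schurPoly_iff μ _).2 (restrict_schurB_mul μ)

theorem coeff_alternant {l : ℕ} (e m : Fin l → ℕ) :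
    (alternant e).coeff (Finsupp.equivFunOnFinite.symm m) =
      ∑ σ : Equiv.Perm (Fin l), if e ∘ σ = m then (((Equiv.Perm.sign σ : ℤˣ) : ℤ) : ℂ) else 0 := by
  rw [alternant, ← Matrix.det_transpose, Matrix.det_apply', MvPolynomial.coeff_sum]
  refine Finset.sum_congr rfl fun σ _ => ?_
  have h1 : ∏ i, (Matrix.of fun i j : Fin l =>
      (MvPolynomial.X i : MvPolynomial (Fin l) ℂ) ^ e j).transpose (σ i) i =
      MvPolynomial.monomial (Finsupp.equivFunOnFinite.symm (e ∘ σ)) 1 := by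
    rw [MvPolynomial.monomial_eq, map_one, one_mul, Finsupp.prod_fintype _ _ (by simp)]
    simp
  have h2 : (((Equiv.Perm.sign σ : ℤˣ) : ℤ) : MvPolynomial (Fin l) ℂ) =
      MvPolynomial.C (((Equiv.Perm.sign σ : ℤˣ) : ℤ) : ℂ) := by simp
  rw [h1, h2, MvPolynomial.C_mul_monomial, mul_one, MvPolynomial.coeff_monomial]
  exact if_congr Finsupp.equivFunOnFinite.symm.injective.eq_iff rfl rfl

theorem coeff_alternant_self {l : ℕ} {e : Fin l → ℕ} (he : Function.Injective e) :
    (alternant e).coeff (Finsupp.equivFunOnFinite.symm e) = 1 := by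
  rw [coeff_alternant, Finset.sum_eq_single 1]
  · simp
  · intro σ _ hσ
    refine if_neg fun h => hσ (Equiv.ext fun i => he ?_)
    exact congrFun h i
  · simp

theorem exists_perm_of_coeff_alternant_ne_zero {l : ℕ} {e m : Fin l → ℕ}
    (h : (alternant e).coeff (Finsupp.equivFunOnFinite.symm m) ≠ 0) :
    ∃ σ : Equiv.Perm (Fin l), e ∘ σ = m := by
  rw [coeff_alternant] at h
  obtain ⟨σ, _, hσ⟩ := Finset.exists_ne_zero_of_sum_ne_zero h
  exact ⟨σ, by by_contra h; exact hσ (if_neg h)⟩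

/-! ### Sorting -/

theorem strictAnti_add_sub_le {l : ℕ} {e : Fin l → ℕ} (he : StrictAnti e) {i j : Fin l}
    (hij : i ≤ j) : e j + (j - i : ℕ) ≤ e i := by
  obtain ⟨d, hd⟩ : ∃ d : ℕ, (j : ℕ) = i + d := ⟨j - i, by have := Fin.le_def.1 hij; omega⟩
  have hd' : (j - i : ℕ) = d := by omega
  rw [hd']
  clear hd' hij
  induction d generalizing j with
  | zero => rw [Fin.ext (show (j : ℕ) = i by omega), add_zero]
  | succ d ih =>
    have h1 := ih (j := ⟨i + d, by omega⟩) rfl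
    have h2 : e j < e ⟨i + d, by omega⟩ := he (Fin.lt_def.2 (by simp only; omega))
    omega

/-- A strictly decreasing sequence of naturals drops by at least one at each step, so it dominates
`δ` and its difference with `δ` is still weakly decreasing. -/
theorem exists_perm_antitone {l : ℕ} {e : Fin l → ℕ} (he : Function.Injective e) :
    ∃ (σ : Equiv.Perm (Fin l)) (lam : Fin l → ℕ), Antitone lam ∧ e ∘ σ = lam + delta l := by
  set σ := Tuple.sort (OrderDual.toDual ∘ e)
  have h1 : Monotone ((OrderDual.toDual ∘ e) ∘ σ) := Tuple.monotone_sort _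
  have h2 : StrictAnti (e ∘ σ) := by
    have h3 : Antitone (e ∘ σ) := fun i j hij => h1 hij
    exact h3.strictAnti_of_injective (he.comp σ.injective)
  have h4 : ∀ i, delta l i ≤ (e ∘ σ) i := by
    intro i
    have hi := i.2
    have := strictAnti_add_sub_le h2 (i := i) (j := ⟨l - 1, by omega⟩)
      (Fin.le_def.2 (by simp only; omega))
    simp only [delta] at this ⊢
    omega
  refine ⟨σ, fun i => (e ∘ σ) i - delta l i, fun i j hij => ?_, ?_⟩
  · have h5 := strictAnti_add_sub_le h2 hij
    have h6 := h4 j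
    have := Fin.le_def.1 hij
    simp only [delta] at h6 ⊢
    omega
  · funext i
    exact (Nat.sub_add_cancel (h4 i)).symm

theorem strictAnti_add_delta {l : ℕ} {lam : Fin l → ℕ} (h : Antitone lam) :
    StrictAnti (lam + delta l) := by
  intro i j hij
  have h1 := h hij.le
  have h2 := Fin.lt_def.1 hij
  simp only [Pi.add_apply, delta]
  omega

theorem eq_of_strictAnti_of_comp_perm {l : ℕ} {e m : Fin l → ℕ} (he : StrictAnti e)
    (hm : StrictAnti m) {σ : Equiv.Perm (Fin l)} (h : e ∘ σ = m) : e = m := by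
  refine (StrictAnti.range_inj he hm).1 ?_
  rw [← h, σ.surjective.range_comp]

/-! ### Equality of `B_μ 1` and `B_ν 1` up to sign -/

theorem schurB_eq_zero {l : ℕ} {μ : Fin l → ℕ} (h : ¬ Function.Injective (μ + delta l)) :
    schurB μ = 0 := by
  rw [schurB, bernsteinComp_eq_bernsteinExp, bernsteinExp_eq_zero h]
  rfl

theorem schurB_of_comp_perm {l : ℕ} {μ ν : Fin l → ℕ} {σ : Equiv.Perm (Fin l)}
    (h : (μ + delta l) ∘ σ = ν + delta l) :
    (bernsteinComp fun i => (ν i : ℤ)) =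
      ((Equiv.Perm.sign σ : ℤˣ) : ℤ) • bernsteinComp fun i => (μ i : ℤ) := by
  rw [bernsteinComp_eq_bernsteinExp, bernsteinComp_eq_bernsteinExp, ← h, bernsteinExp_comp_perm]

theorem schurB_ne_zero {l : ℕ} {μ : Fin l → ℕ} (h : Function.Injective (μ + delta l)) :
    schurB μ ≠ 0 := by
  intro h0
  have h1 := restrict_schurB_mul μ
  rw [h0, map_zero, zero_mul] at h1
  have h2 := coeff_alternant_self h
  rw [← h1, MvPolynomial.coeff_zero] at h2
  exact zero_ne_one h2

/-- An equality at the single vector `1` lifts to the operators: the monomials of the alternant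
recover `μ + δ` up to order, and the order only affects the sign. -/
theorem schurB_eq_smul_iff {l : ℕ} (μ ν : Fin l → ℕ) (s : ℤˣ) :
    schurB μ = (s : ℤ) • schurB ν ↔
      (bernsteinComp fun i => (μ i : ℤ)) = (s : ℤ) • bernsteinComp fun i => (ν i : ℤ) := by
  constructor
  · intro h
    by_cases hμ : Function.Injective (μ + delta l)
    · have h1 : alternant (μ + delta l) = (s : ℤ) • alternant (ν + delta l) := by
        rw [← restrict_schurB_mul, h, map_zsmul, smul_mul_assoc, restrict_schurB_mul]
      have h2 := coeff_alternant_self hμ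
      rw [h1] at h2
      obtain ⟨σ, hσ⟩ := exists_perm_of_coeff_alternant_ne_zero (e := ν + delta l)
        (m := μ + delta l) fun h0 => by
          rw [← MvPolynomial.coeffAddMonoidHom_apply, map_zsmul,
            MvPolynomial.coeffAddMonoidHom_apply, h0, smul_zero] at h2
          exact zero_ne_one h2
      have h3 := schurB_of_comp_perm hσ
      have h4 : schurB μ = ((Equiv.Perm.sign σ : ℤˣ) : ℤ) • schurB ν := by
        rw [schurB, h3]
        rfl
      have hν : schurB ν ≠ 0 := fun h0 => schurB_ne_zero hμ (by rw [h, h0, smul_zero])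
      -- Since `schurB ν` is nonzero, the sign of the permutation must be `s`.
      rw [h3, smul_left_injective ℤ hν (h4.symm.trans h)]
    · have h1 : schurB ν = 0 := by
        rw [schurB_eq_zero hμ] at h
        exact (smul_eq_zero.1 h.symm).resolve_left s.ne_zero
      have hν : ¬ Function.Injective (ν + delta l) := fun hν => schurB_ne_zero hν h1
      rw [bernsteinComp_eq_bernsteinExp, bernsteinComp_eq_bernsteinExp, bernsteinExp_eq_zero hμ,
        bernsteinExp_eq_zero hν, smul_zero]
  · intro h
    rw [schurB, h]
    rfl

/-! ### Classical Schur functions -/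

/-- The extension of a finite sequence by zeros. -/
def extendZero {k : ℕ} (lam : Fin k → ℕ) (N : ℕ) : Fin N → ℕ :=
  fun i => if h : (i : ℕ) < k then lam ⟨i, h⟩ else 0

theorem bernstein_zero_one : bernstein 0 1 = 1 := by
  rw [← sub_eq_zero]
  refine eq_zero_of_evalSet_eq_zero (N₀ := 1) fun S hS => ?_
  rw [map_sub, evalSet_bernstein S (e := S.card - 1) (by omega)]
  simp only [map_one, mul_one]
  have h := dividedPow_eq_coeff (S := S) (k := S.card - 1) (by omega)
  rw [if_pos (by omega), dividedPow] at h
  rw [h, sub_self]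

/-- Trailing zeros only apply `B_0` to `1`, which fixes it. Hence one symmetric function gives the
Schur polynomials in every number of variables. -/
theorem schurB_extendZero {k N : ℕ} (hN : k ≤ N) (lam : Fin k → ℕ) :
    schurB (extendZero lam N) = schurB lam := by
  obtain ⟨m, rfl⟩ := Nat.exists_eq_add_of_le hN
  have h1 : (fun i : Fin m => bernstein (extendZero lam (k + m) (Fin.natAdd k i) : ℕ)) =
      fun _ => bernstein 0 := by
    funext i
    simp [extendZero]
  have h2 : (fun i : Fin k => bernstein (extendZero lam (k + m) (i.castLE hN) : ℕ)) =
      fun i => bernstein (lam i) := by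
    funext i
    simp [extendZero]
  have h3 : ∀ m : ℕ, ((bernstein 0) ^ m) 1 = 1 := by
    intro m
    induction m with
    | zero => rfl
    | succ m ih => rw [pow_succ, Module.End.mul_apply, bernstein_zero_one, ih]
  rw [schurB, schurB, bernsteinComp, bernsteinComp, List.ofFn_add, List.prod_append, h1, h2,
    List.ofFn_const, List.prod_replicate, Module.End.mul_apply, h3]

theorem eq_of_isClassicalSchur {k : ℕ} {lam : Fin k → ℕ} {f g : Lam}
    (hf : IsClassicalSchur lam f) (hg : IsClassicalSchur lam g) : f = g := by
  rw [← sub_eq_zero]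
  refine eq_zero_of_restrict_eq_zero (N₀ := k) fun N hN => ?_
  rw [map_sub, sub_eq_zero]
  exact IsFractionRing.injective (MvPolynomial (Fin N) ℂ) (FractionRing (MvPolynomial (Fin N) ℂ))
    ((hf N hN).trans (hg N hN).symm)

theorem isClassicalSchur_schurB {k : ℕ} (lam : Fin k → ℕ) :
    IsClassicalSchur lam (schurB lam) := by
  intro N hN
  rw [← schurB_extendZero hN]
  exact algebraMap_restrict_schurB _

theorem antitone_extendZero {k : ℕ} {lam : Fin k → ℕ} (h : Antitone lam) (N : ℕ) :
    Antitone (extendZero lam N) := by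
  intro i j hij
  have hij' := Fin.le_def.1 hij
  simp only [extendZero]
  split_ifs with h1 h2
  · exact h (Fin.le_def.2 hij')
  · omega
  · exact Nat.zero_le _
  · exact le_rfl

theorem iSup_LamLen_le (l : ℕ) : (⨆ k ∈ Finset.range (l + 1), LamLen k) ≤
    Submodule.span ℂ (Set.range fun lam : {lam : Fin l → ℕ // Antitone lam} => schurB lam.1) := by
  refine iSup₂_le fun k hk => Submodule.span_le.2 ?_
  rintro f ⟨lam, h1, _, h3⟩
  have hkl : k ≤ l := Nat.lt_succ_iff.1 (Finset.mem_range.1 hk)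
  refine Submodule.subset_span ⟨⟨extendZero lam l, antitone_extendZero h1 l⟩, ?_⟩
  rw [eq_of_isClassicalSchur h3 (isClassicalSchur_schurB lam)]
  exact schurB_extendZero hkl lam

theorem schurB_mem_of_antitone {l : ℕ} {lam : Fin l → ℕ} (h : Antitone lam) :
    schurB lam ∈ ⨆ k ∈ Finset.range (l + 1), LamLen k := by
  classical
  -- The least such `k` is the number of positive parts of `lam`.
  have hex : ∃ k : ℕ, ∀ i : Fin l, k ≤ i → lam i = 0 := ⟨l, fun i hi => by omega⟩
  set k := Nat.find hex
  have hk : ∀ i : Fin l, k ≤ i → lam i = 0 := Nat.find_spec hex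
  have hkl : k ≤ l := Nat.find_le fun i hi => by omega
  have hpos : ∀ i : Fin k, 0 < lam (i.castLE hkl) := by
    intro i
    by_contra h0
    refine Nat.find_min hex i.2 fun j hj => ?_
    have := h (Fin.le_def.2 hj : i.castLE hkl ≤ j)
    omega
  have hext : extendZero (fun i : Fin k => lam (i.castLE hkl)) l = lam := by
    funext i
    simp only [extendZero]
    split_ifs with hi
    · rfl
    · exact (hk i (not_lt.1 hi)).symm
  refine Submodule.mem_iSup_of_mem k (Submodule.mem_iSup_of_mem
    (Finset.mem_range.2 (by omega)) (Submodule.subset_span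
      ⟨fun i => lam (i.castLE hkl), fun i j hij => h (Fin.le_def.2 hij), hpos, ?_⟩))
  nth_rewrite 2 [← hext]
  rw [schurB_extendZero hkl]
  exact isClassicalSchur_schurB _

theorem schurB_mem {l : ℕ} (μ : Fin l → ℕ) :
    schurB μ ∈ ⨆ k ∈ Finset.range (l + 1), LamLen k := by
  by_cases hμ : Function.Injective (μ + delta l)
  · obtain ⟨σ, lam, h1, h2⟩ := exists_perm_antitone hμ
    have h3 := schurB_of_comp_perm h2
    have h4 : schurB lam = ((Equiv.Perm.sign σ : ℤˣ) : ℤ) • schurB μ := by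
      rw [schurB, h3]
      rfl
    have h5 : schurB μ = ((Equiv.Perm.sign σ : ℤˣ) : ℤ) • schurB lam := by
      rw [h4, smul_smul, ← Units.val_mul, Int.units_mul_self, Units.val_one, one_smul]
    rw [h5]
    exact zsmul_mem (schurB_mem_of_antitone h1) _
  · rw [schurB_eq_zero hμ]
    exact Submodule.zero_mem _

/-! ### Uniqueness of the Schur function and the passage to codes -/

/-- Among the alternants of shifted partitions, only that of `κ + δ` contains the monomial of
exponent `κ + δ`, so its coefficient in the restriction times `a_δ` is the coefficient of `s_κ`. -/
theorem eq_zero_of_mem_of_restrict_eq_zero {l : ℕ} {f : Lam}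
    (hf : f ∈ ⨆ k ∈ Finset.range (l + 1), LamLen k) (h : restrict l f = 0) : f = 0 := by
  obtain ⟨c, rfl⟩ := (Finsupp.mem_span_range_iff_exists_finsupp).1 (iSup_LamLen_le l hf)
  have hc : c = 0 := by
    ext kap
    have h1 : (restrict l (c.sum fun lam a => a • schurB lam.1) * alternant (delta l)).coeff
        (Finsupp.equivFunOnFinite.symm (kap.1 + delta l)) = 0 := by
      rw [h, zero_mul, MvPolynomial.coeff_zero]
    rw [Finsupp.sum, map_sum, Finset.sum_mul, MvPolynomial.coeff_sum] at h1
    simp only [map_smul, smul_mul_assoc, restrict_schurB_mul, MvPolynomial.coeff_smul] at h1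
    rw [Finset.sum_eq_single kap] at h1
    · rwa [coeff_alternant_self (strictAnti_add_delta kap.2).injective, smul_eq_mul,
        mul_one] at h1
    · intro lam _ hne
      have h2 : (alternant (lam.1 + delta l)).coeff
          (Finsupp.equivFunOnFinite.symm (kap.1 + delta l)) = 0 := by
        by_contra h0
        obtain ⟨σ, hσ⟩ := exists_perm_of_coeff_alternant_ne_zero h0
        have h3 := eq_of_strictAnti_of_comp_perm (strictAnti_add_delta lam.2)
          (strictAnti_add_delta kap.2) hσ
        exact hne (Subtype.ext (add_right_cancel h3))
      rw [h2, smul_zero]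
    · intro hk
      rw [Finsupp.notMem_support_iff.1 hk, zero_smul]
  rw [hc, Finsupp.sum_zero_index]

theorem isSchurFunction_iff {l : ℕ} (μ : Fin l → ℕ) (f : Lam) :
    IsSchurFunction μ f ↔ f = schurB μ := by
  constructor
  · rintro ⟨h1, h2⟩
    rw [← sub_eq_zero]
    refine eq_zero_of_mem_of_restrict_eq_zero (Submodule.sub_mem _ h1 (schurB_mem μ)) ?_
    rw [map_sub, sub_eq_zero]
    exact IsFractionRing.injective (MvPolynomial (Fin l) ℂ)
      (FractionRing (MvPolynomial (Fin l) ℂ)) (h2.trans (algebraMap_restrict_schurB μ).symm)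
  · rintro rfl
    exact ⟨schurB_mem μ, algebraMap_restrict_schurB μ⟩

theorem existsUnique_isSchurFunction {l : ℕ} (μ : Fin l → ℕ) : ∃! f, IsSchurFunction μ f :=
  ⟨schurB μ, (isSchurFunction_iff μ _).2 rfl, fun _ h => (isSchurFunction_iff μ _).1 h⟩

theorem schurFunction_eq_schurB {l : ℕ} (μ : Fin l → ℕ) : schurFunction μ = schurB μ :=
  (isSchurFunction_iff μ _).1 (Classical.epsilon_spec (existsUnique_isSchurFunction μ).exists)

/-- Codes of a fixed length determine their compositions, so the witnesses in the relation must be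
`μ` and `ν`. -/
theorem codeSim_code_iff {l : ℕ} (μ ν : Fin l → ℤ) (s : ℤˣ) :
    CodeSim l (1, code μ) (s, code ν) ↔ bernsteinComp μ = (s : ℤ) • bernsteinComp ν := by
  constructor
  · rintro ⟨μ', ν', h1, h2, h3⟩
    rw [code_injective h1, code_injective h2] at h3
    simpa using h3
  · intro h
    exact ⟨μ, ν, rfl, rfl, by simpa using h⟩

end SchurCode

end

theorem theorem5p3 (l : ℕ) (μ ν : Fin l → ℕ) (α β : SchurCode.Code)
    (hα : α = SchurCode.code fun i => (μ i : ℤ)) (hβ : β = SchurCode.code fun i => (ν i : ℤ)) :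
    (∃! f, SchurCode.IsSchurFunction μ f) ∧ (∃! f, SchurCode.IsSchurFunction ν f) ∧
    (SchurCode.schurFunction μ = SchurCode.schurFunction ν ↔
      SchurCode.CodeSim l (1, α) (1, β)) ∧
    (SchurCode.schurFunction μ = -SchurCode.schurFunction ν ↔
      SchurCode.CodeSim l (1, α) (-1, β)) := by
  subst hα hβ
  refine ⟨SchurCode.existsUnique_isSchurFunction μ, SchurCode.existsUnique_isSchurFunction ν,
    ?_, ?_⟩
  · rw [SchurCode.codeSim_code_iff, ← SchurCode.schurB_eq_smul_iff,
      SchurCode.schurFunction_eq_schurB, SchurCode.schurFunction_eq_schurB, Units.val_one, one_smul]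
  · rw [SchurCode.codeSim_code_iff, ← SchurCode.schurB_eq_smul_iff,
      SchurCode.schurFunction_eq_schurB, SchurCode.schurFunction_eq_schurB, Units.val_neg,
      Units.val_one, neg_smul, one_smul]
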